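/- Consider a Markov decision process with a finite state space $\mathcal S$ and a finite action space $\mathcal A$, transition probabilities $P_a(s,s')$, rewards $R_a(s,s')\in\mathbb R$ and difficulty contributions $D_a(s,s')\ge 0$. A policy is a map $\pi:\mathcal S\to\mathcal A$. Under $\pi$ the states $s_0,s_1,s_2,\dots$ form a Markov chain started at a fixed state $s_0=s_{\rm init}$; write $R_t=R_{\pi(s_{t-1})}(s_{t-1},s_t)$ and $D_t=D_{\pi(s_{t-1})}(s_{t-1},s_t)$ for $t\ge 1$. Assume: 1. there is a constant $R_{\max}$ with $|R_a(s,s')|\le R_{\max}$ for all $a,s,s'$; 2. there is a constant $D_{\max}$ with $0\le D_a(s,s')\le D_{\max}$ for all $a,s,s'$; 3. there is $\varepsilon>0$ such that $\mathbb E^{\pi}\bigl[\lim_{T\to\infty}\frac1T\sum_{t=1}^{T}D_t\bigr]>\varepsilon$ for every policy $\pi$; 4. $s_{\rm init}$ is positive recurrent under every policy $\pi$: the chain started at $s_{\rm init}$ returns to it almost surely, and the expected return time is finite. For a real number $H>1$, the probabilistic-termination process (PT-MDP) runs like the original process from $s_{\rm init}$, but after the $t$-th transition (with reward $R_t$ and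 difficulty contribution $D_t$) it moves to an absorbing terminal state of zero reward with probability $1-(1-\frac1H)^{D_t}$ and continues with probability $(1-\frac1H)^{D_t}$. Let $\mathrm{Term}(H)\ge 1$ be the step at which it terminates. Define $$\mathrm{REV}_{\rm ARR}^{\pi}=\mathbb E^{\pi}\Bigl[\lim_{T\to\infty}\frac{\sum_{t=1}^{T}R_t}{\sum_{t=1}^{T}D_t}\Bigr],\qquad \mathrm{REV}_{\rm PT}^{\pi}(H)=\mathbb E^{\pi}\Bigl[\frac1H\sum_{t=1}^{\mathrm{Term}(H)}R_t\Bigr].$$ Then for every policy $\pi$ both revenues are well defined (the limit exists almost surely and is integrable; for every $H>1$, $\mathrm{Term}(H)<\infty$ almost surely and $\sum_{t=1}^{\mathrm{Term}(H)}R_t$ is integrable), and $$\bigl|\mathrm{REV}_{\rm ARR}^{\pi}-\mathrm{REV}_{\rm PT}^{\pi}(H)\bigr|=O\!\left(\frac1H\right),$$ i.e. there is a constant $C$, independent of $H$, such that the left-hand side is at most $C/H$ for all real $H>1$. -/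

import Mathlib

open MeasureTheory ProbabilityTheory Filter Topology
open scoped ENNReal BigOperators

noncomputable section

/-- A Markov decision process on a finite state space in which every transition `s → s'` under an
action `a` has probability `P a s s'` and carries a scalar reward `R a s s'` and a nonnegative
difficulty contribution `D a s s'`. -/
structure MDP (S A : Type*) [Fintype S] where
  P : A → S → S → ℝ
  P_nonneg : ∀ a s s', 0 ≤ P a s s'
  P_sum : ∀ a s, ∑ s', P a s s' = 1
  R : A → S → S → ℝ
  D : A → S → S → ℝ
  D_nonneg : ∀ a s s', 0 ≤ D a s s'

namespace MDP

section Chain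

variable {S A : Type*} [Fintype S] [MeasurableSpace S] [DiscreteMeasurableSpace S]

/-- One-step transition kernel of the Markov chain induced by the policy `π`. -/
def stepKernel (M : MDP S A) (π : S → A) : Kernel S S :=
  Kernel.ofFunOfCountable fun s =>
    ∑ s', ENNReal.ofReal (M.P (π s) s s') • Measure.dirac s'

instance (M : MDP S A) (π : S → A) : IsMarkovKernel (M.stepKernel π) := by
  refine ⟨fun s => ⟨?_⟩⟩
  change (∑ s', ENNReal.ofReal (M.P (π s) s s') • Measure.dirac s') Set.univ = 1
  simp only [Measure.finsetSum_apply, Measure.smul_apply, measure_univ, smul_eq_mul, mul_one]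
  rw [← ENNReal.ofReal_sum_of_nonneg fun s' _ => M.P_nonneg _ _ _, M.P_sum, ENNReal.ofReal_one]

/-- Law, on the space of state sequences `(s_0, s_1, …)`, of the Markov chain induced by the
policy `π` and started at `s₀`. -/
def law (M : MDP S A) (π : S → A) (s₀ : S) : Measure (ℕ → S) :=
  Kernel.traj (X := fun _ => S)
    (fun n => (M.stepKernel π).comap
      (fun h : (i : Finset.Iic n) → S => h ⟨n, Finset.mem_Iic.2 le_rfl⟩)
      (measurable_pi_apply _)) 0 (fun _ => s₀)

/-- `∑_{t=1}^T R_t`, where `R_t` is the reward of the `t`-th transition `s_{t-1} → s_t`. -/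
def cumReward (M : MDP S A) (π : S → A) (T : ℕ) (ω : ℕ → S) : ℝ :=
  ∑ t ∈ Finset.range T, M.R (π (ω t)) (ω t) (ω (t + 1))

/-- `∑_{t=1}^T D_t`, where `D_t` is the difficulty contribution of the transition
`s_{t-1} → s_t`. -/
def cumDifficulty (M : MDP S A) (π : S → A) (T : ℕ) (ω : ℕ → S) : ℝ :=
  ∑ t ∈ Finset.range T, M.D (π (ω t)) (ω t) (ω (t + 1))

/-- `E^π [lim_{T → ∞} (1 / T) ∑_{t=1}^T D_t]`. -/
def avgDifficulty (M : MDP S A) (π : S → A) (s₀ : S) : ℝ :=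
  ∫ ω, limUnder atTop (fun T : ℕ => (1 / (T : ℝ)) * M.cumDifficulty π T ω) ∂(M.law π s₀)

/-- Number of steps until the first return to `s`; it is `⊤` if there is no return. -/
def returnTime (s : S) (ω : ℕ → S) : ℕ∞ :=
  ⨅ t : ℕ, ⨅ _ : 1 ≤ t ∧ ω t = s, (t : ℕ∞)

/-- The state `s` is positive recurrent under `π`: the chain started at `s` returns to `s` almost
surely, and the expected return time is finite. -/
def IsPositiveRecurrent (M : MDP S A) (π : S → A) (s : S) : Prop :=
  (∀ᵐ ω ∂(M.law π s), ∃ t : ℕ, 1 ≤ t ∧ ω t = s) ∧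
    ∫⁻ ω, ((returnTime s ω : ℕ∞) : ℝ≥0∞) ∂(M.law π s) < ⊤

/-- `lim_{T → ∞} (∑_{t=1}^T R_t) / (∑_{t=1}^T D_t)` along a state sequence. -/
def limitRatio (M : MDP S A) (π : S → A) (ω : ℕ → S) : ℝ :=
  limUnder atTop (fun T : ℕ => M.cumReward π T ω / M.cumDifficulty π T ω)

/-- The average-reward-ratio revenue of the policy `π`, started at `s₀`. -/
def revARR (M : MDP S A) (π : S → A) (s₀ : S) : ℝ :=
  ∫ ω, M.limitRatio π ω ∂(M.law π s₀)

end Chain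

section PT

variable {S A : Type*} [Fintype S]

/-- Probability of continuing after a transition with difficulty contribution `d`. -/
def contProb (H d : ℝ) : ℝ := (1 - 1 / H) ^ d

theorem contProb_nonneg {H : ℝ} (hH : 1 < H) (d : ℝ) : 0 ≤ contProb H d := by
  have : 1 / H ≤ 1 := by rw [div_le_one (by linarith)]; exact hH.le
  exact Real.rpow_nonneg (by linarith) d

theorem contProb_le_one {H d : ℝ} (hH : 1 < H) (hd : 0 ≤ d) : contProb H d ≤ 1 := by
  have h1 : 1 / H ≤ 1 := by rw [div_le_one (by linarith)]; exact hH.le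
  have h0 : 0 ≤ 1 / H := by positivity
  exact Real.rpow_le_one (by linarith) (by linarith) hd

open Classical in
/-- The probabilistic-termination MDP with parameter `H`. A state `(s, true)` is the state `s` of
the original process. The states `(s, false)` together form the terminal state: they are absorbing,
with zero reward and difficulty, and the first coordinate only remembers the transition after which
the process stopped. From `(s, true)`, a transition `s → s'` is drawn as in the original process,
with its reward and difficulty contribution `d`; the process then goes on with probability
`(1 - 1/H)^d` and terminates with probability `1 - (1 - 1/H)^d`. -/
def ptMDP (M : MDP S A) (H : ℝ) (hH : 1 < H) : MDP (S × Bool) A where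
  P a x y :=
    match x, y with
    | (s, true), (s', true) => M.P a s s' * contProb H (M.D a s s')
    | (s, true), (s', false) => M.P a s s' * (1 - contProb H (M.D a s s'))
    | (_, false), _ => if y = x then 1 else 0
  P_nonneg := by
    rintro a ⟨s, _ | _⟩ ⟨s', _ | _⟩
    · dsimp only; split_ifs <;> norm_num
    · dsimp only; split_ifs <;> norm_num
    · exact mul_nonneg (M.P_nonneg _ _ _)
        (sub_nonneg.2 (contProb_le_one hH (M.D_nonneg _ _ _)))
    · exact mul_nonneg (M.P_nonneg _ _ _) (contProb_nonneg hH _)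
  P_sum := by
    rintro a ⟨s, _ | _⟩
    · simp
    · rw [Fintype.sum_prod_type]
      refine Eq.trans ?_ (M.P_sum a s)
      refine Finset.sum_congr rfl fun s' _ => ?_
      rw [Fintype.sum_bool]
      ring
  R a x y := if x.2 = true then M.R a x.1 y.1 else 0
  D a x y := if x.2 = true then M.D a x.1 y.1 else 0
  D_nonneg := by
    intro a x y
    split_ifs
    · exact M.D_nonneg _ _ _
    · exact le_rfl

/-- A policy of the original process, used in the probabilistic-termination process. -/
def ptPolicy (π : S → A) : S × Bool → A := fun x => π x.1

/-- The first step after which the process has stopped (`0` if it never stops). -/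
def term (ω : ℕ → S × Bool) : ℕ := sInf {t : ℕ | 1 ≤ t ∧ (ω t).2 = false}

/-- `∑_{t=1}^{Term(H)} R_t`. -/
def ptReward (M : MDP S A) (π : S → A) (H : ℝ) (hH : 1 < H) (ω : ℕ → S × Bool) : ℝ :=
  (M.ptMDP H hH).cumReward (ptPolicy π) (term ω) ω

variable [MeasurableSpace S] [DiscreteMeasurableSpace S]

/-- Law of the probabilistic-termination process under the policy `π`, started at `s₀`. -/
def ptLaw (M : MDP S A) (π : S → A) (s₀ : S) (H : ℝ) (hH : 1 < H) : Measure (ℕ → S × Bool) :=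
  (M.ptMDP H hH).law (ptPolicy π) (s₀, true)

/-- The probabilistic-termination revenue of the policy `π`, started at `s₀`. -/
def revPT (M : MDP S A) (π : S → A) (s₀ : S) (H : ℝ) (hH : 1 < H) : ℝ :=
  ∫ ω, (1 / H) * M.ptReward π H hH ω ∂(M.ptLaw π s₀ H hH)

end PT

end MDP

end

namespace MDP

/-! ### Integration against the path law and the Markov property. -/

section Chain

variable {S A : Type*} [Fintype S] [MeasurableSpace S] [DiscreteMeasurableSpace S]

/-! Both revenues are governed by the Poisson equation. Almost sure return to `sInit` makes the
states reachable from it a single finite irreducible class (`reach_of_ae_return`), and on that class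
every `f` satisfies `f + P g - g = b` for some constant `b` and some bounded `g` (`exists_poisson`).
Let `b, g` belong to the reward and `c, h` to the difficulty.

Ratio revenue: the reward sum minus `b * T` is a sum of bounded, centred, orthogonal terms plus a
bounded telescoping term, so the time averages of reward and difficulty converge almost surely to
`b` and `c` (`ae_tendsto_average`). The assumption on average difficulty forces `c > 0`, and the
ratio tends to `b / c`.

Termination revenue: let `N` be the expected number of transitions made, the terminating one
included. The telescoping survives termination, so expected reward is `b * N` and expected
difficulty is `c * N`, with errors controlled by the sup norms of `g` and `h` whatever `H` is
(`abs_sum_aliveMean_sub_le`). A transition of difficulty `d` stops the process with probability `d /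
H` up to a relative error `O(1 / H)`, and the stopping probabilities sum to at most `1`, so expected
difficulty is `H + O(1)` (`abs_sum_difficulty_sub_le`). Hence `N = H / c + O(1)`, expected reward is
`b / c * H + O(1)`, and dividing by `H` gives the bound. -/

instance (M : MDP S A) (π : S → A) (s₀ : S) : IsProbabilityMeasure (M.law π s₀) := by
  unfold law; infer_instance

/-- A function of finitely many coordinates factors through the restriction to them. -/
theorem exists_eq_comp_frestrictLe {S β : Type*} {n : ℕ} {F : (ℕ → S) → β}
    (hF : DependsOn F (Set.Iic n)) :
    ∃ G : ((i : Finset.Iic n) → S) → β, F = G ∘ Preorder.frestrictLe (π := fun _ => S) n := by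
  -- Coordinates beyond `n` are irrelevant to `F`; they are filled by repeating the `n`-th.
  refine ⟨fun x => F fun i => if h : i ≤ n then x ⟨i, Finset.mem_Iic.2 h⟩
    else x ⟨n, Finset.mem_Iic.2 le_rfl⟩, ?_⟩
  ext ω
  refine hF fun i hi => ?_
  have : i ≤ n := hi
  simp [this]

/-- Since `S` is finite, such a function takes finitely many values. This settles integrability at
every fixed time. -/
theorem integrable_of_dependsOn (μ : Measure (ℕ → S)) [IsFiniteMeasure μ] {n : ℕ}
    {F : (ℕ → S) → ℝ} (hF : DependsOn F (Set.Iic n)) : Integrable F μ := by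
  obtain ⟨G, rfl⟩ := exists_eq_comp_frestrictLe hF
  exact (Integrable.of_finite).comp_measurable (Preorder.measurable_frestrictLe n)

/-- Conditional mean of `φ s s'` over a transition `s → s'` under the policy `π`. -/
noncomputable def stepMean (M : MDP S A) (π : S → A) (φ : S → S → ℝ) (s : S) : ℝ :=
  ∑ s', M.P (π s) s s' * φ s s'

theorem integral_stepKernel (M : MDP S A) (π : S → A) (s : S) (f : S → ℝ) :
    ∫ y, f y ∂(M.stepKernel π s) = ∑ s', M.P (π s) s s' * f s' := by
  change ∫ y, f y ∂(∑ s', ENNReal.ofReal (M.P (π s) s s') • Measure.dirac s') = _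
  have hfin : ∀ s', IsFiniteMeasure (ENNReal.ofReal (M.P (π s) s s') • Measure.dirac s') :=
    fun s' => ⟨by simp⟩
  rw [integral_finsetSum_measure fun _ _ => Integrable.of_finite]
  refine Finset.sum_congr rfl fun s' _ => ?_
  rw [integral_smul_measure, integral_dirac, ENNReal.toReal_ofReal (M.P_nonneg _ _ _), smul_eq_mul]

theorem ae_law_zero (M : MDP S A) (π : S → A) (s₀ : S) : ∀ᵐ ω ∂(M.law π s₀), ω 0 = s₀ := by
  have h : (M.law π s₀).map (Preorder.frestrictLe (π := fun _ => S) 0) =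
      Measure.dirac fun _ => s₀ := by
    rw [law, Kernel.traj_map_frestrictLe_apply, Kernel.partialTraj_self, Kernel.id_apply]
  refine ae_of_ae_map (f := Preorder.frestrictLe (π := fun _ => S) 0)
    (p := fun x => x ⟨0, Finset.mem_Iic.2 le_rfl⟩ = s₀)
    (Preorder.measurable_frestrictLe 0).aemeasurable ?_
  rw [h, ae_dirac_iff (DiscreteMeasurableSpace.forall_measurableSet _)]

/-- The Markov property: a factor depending on the past up to time `n` does not interfere with
averaging over the transition at time `n`. -/
theorem integral_mul_step (M : MDP S A) (π : S → A) (s₀ : S) {n : ℕ} {F : (ℕ → S) → ℝ}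
    (hF : DependsOn F (Set.Iic n)) (φ : S → S → ℝ) :
    ∫ ω, F ω * φ (ω n) (ω (n + 1)) ∂(M.law π s₀) =
      ∫ ω, F ω * M.stepMean π φ (ω n) ∂(M.law π s₀) := by
  obtain ⟨G, rfl⟩ := exists_eq_comp_frestrictLe hF
  have hn : n ∈ Finset.Iic n := Finset.mem_Iic.2 le_rfl
  -- The joint law of the past up to `n` and the next state is the law of the past composed with the
  -- step kernel.
  have hκ := Kernel.partialTraj_compProd_eq_map_traj (X := fun _ => S)
    (κ := fun n => (M.stepKernel π).comap
      (fun h : (i : Finset.Iic n) → S => h ⟨n, Finset.mem_Iic.2 le_rfl⟩)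
      (measurable_pi_apply _)) (Nat.zero_le n) (x₀ := fun _ => s₀)
  have h1 := integral_map (μ := M.law π s₀)
    (φ := fun x : ℕ → S => (Preorder.frestrictLe (π := fun _ => S) n x, x (n + 1)))
    (f := fun p => G p.1 * φ (p.1 ⟨n, hn⟩) p.2)
    (by fun_prop) (Measurable.of_discrete).aestronglyMeasurable
  have h2 := integral_map (μ := M.law π s₀)
    (φ := Preorder.frestrictLe (π := fun _ => S) n)
    (f := fun p => G p * M.stepMean π φ (p ⟨n, hn⟩))
    (by fun_prop) (Measurable.of_discrete).aestronglyMeasurable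
  refine h1.symm.trans (Eq.trans ?_ h2)
  rw [law, ← hκ, Kernel.traj_map_frestrictLe_apply, Measure.integral_compProd Integrable.of_finite]
  refine integral_congr_ae (ae_of_all _ fun x => ?_)
  dsimp only
  rw [Kernel.comap_apply, integral_stepKernel, stepMean, Finset.mul_sum]
  exact Finset.sum_congr rfl fun _ _ => by ring

theorem integral_step (M : MDP S A) (π : S → A) (s₀ : S) (n : ℕ) (φ : S → S → ℝ) :
    ∫ ω, φ (ω n) (ω (n + 1)) ∂(M.law π s₀) = ∫ ω, M.stepMean π φ (ω n) ∂(M.law π s₀) := by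
  simpa using M.integral_mul_step π s₀ (n := n) (F := fun _ => 1) (fun _ _ _ => rfl) φ

/-- A transition of probability zero almost surely never happens. -/
theorem ae_law_transition (M : MDP S A) (π : S → A) (s₀ : S) :
    ∀ᵐ ω ∂(M.law π s₀), ∀ n, 0 < M.P (π (ω n)) (ω n) (ω (n + 1)) := by
  classical
  rw [ae_all_iff]
  intro n
  set φ : S → S → ℝ := fun s s' => if 0 < M.P (π s) s s' then 0 else 1
  have hφ : ∀ s, M.stepMean π φ s = 0 := fun s =>
    Finset.sum_eq_zero fun s' _ => by
      by_cases h : 0 < M.P (π s) s s'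
      · simp [φ, h]
      · rw [le_antisymm (not_lt.1 h) (M.P_nonneg _ _ _), zero_mul]
  have h := M.integral_step π s₀ n φ
  simp only [hφ, integral_zero] at h
  have hint : Integrable (fun ω : ℕ → S => φ (ω n) (ω (n + 1))) (M.law π s₀) :=
    integrable_of_dependsOn (n := n + 1) _ fun x y hxy => by
      rw [hxy n (Nat.le_succ n), hxy (n + 1) Set.self_mem_Iic]
  have hnn : 0 ≤ fun ω : ℕ → S => φ (ω n) (ω (n + 1)) := fun ω => by
    dsimp only [φ, Pi.zero_apply]; split_ifs <;> norm_num
  filter_upwards [(integral_eq_zero_iff_of_nonneg hnn hint).1 h] with ω hω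
  by_contra hc
  simp [φ, hc] at hω

end Chain

/-! ### Reachability, the maximum principle and the Poisson equation. -/

section Reach

variable {S A : Type*} [Fintype S]

/-- `s'` can be reached from `s` under the policy `π` by transitions of positive probability. -/
def Reach (M : MDP S A) (π : S → A) : S → S → Prop :=
  Relation.ReflTransGen fun x y => 0 < M.P (π x) x y

/-- The mean of `h` after one transition from `s` under the policy `π`. -/
noncomputable def nextMean (M : MDP S A) (π : S → A) (h : S → ℝ) (s : S) : ℝ :=
  ∑ s', M.P (π s) s s' * h s'

theorem nextMean_le (M : MDP S A) (π : S → A) {h : S → ℝ} {m : ℝ} (hm : ∀ s, h s ≤ m) (s : S) :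
    M.nextMean π h s ≤ m := by
  calc M.nextMean π h s ≤ ∑ s', M.P (π s) s s' * m :=
        Finset.sum_le_sum fun s' _ => mul_le_mul_of_nonneg_left (hm s') (M.P_nonneg _ _ _)
    _ = m := by rw [← Finset.sum_mul, M.P_sum, one_mul]

theorem eq_of_nextMean_eq (M : MDP S A) (π : S → A) {h : S → ℝ} {m : ℝ} (hm : ∀ s, h s ≤ m)
    {s s' : S} (hs : M.nextMean π h s = m) (hss' : 0 < M.P (π s) s s') : h s' = m := by
  have h0 : ∑ x, M.P (π s) s x * (m - h x) = 0 := by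
    simp only [mul_sub, Finset.sum_sub_distrib]
    rw [← Finset.sum_mul, M.P_sum, one_mul]
    exact sub_eq_zero.2 hs.symm
  have h1 := (Finset.sum_eq_zero_iff_of_nonneg fun x _ =>
    mul_nonneg (M.P_nonneg (π s) s x) (sub_nonneg.2 (hm x))).1 h0 s' (Finset.mem_univ _)
  rcases mul_eq_zero.1 h1 with h2 | h2
  · exact absurd h2 hss'.ne'
  · linarith

open Classical in
/-- The generator `h - P h` of the chain, with every state that is not reachable from `s₀`
redirected to `s₀`. -/
noncomputable def generator (M : MDP S A) (π : S → A) (s₀ : S) (h : S → ℝ) (s : S) : ℝ :=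
  if M.Reach π s₀ s then h s - M.nextMean π h s else h s - h s₀

theorem generator_nonneg_of_max (M : MDP S A) (π : S → A) {s₀ : S} {h : S → ℝ} {s : S}
    (hs : ∀ x, h x ≤ h s) : 0 ≤ M.generator π s₀ h s := by
  unfold generator
  split_ifs
  · exact sub_nonneg.2 (M.nextMean_le π hs s)
  · exact sub_nonneg.2 (hs s₀)

/-- Maximum principle. -/
theorem le_of_generator_eq_zero (M : MDP S A) (π : S → A) {s₀ : S} {h : S → ℝ}
    (hback : ∀ s, M.Reach π s₀ s → M.Reach π s s₀) (h0 : ∀ s, M.generator π s₀ h s = 0) (s : S) :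
    h s ≤ h s₀ := by
  have : Nonempty S := ⟨s₀⟩
  obtain ⟨x, hx⟩ := Finite.exists_max h
  refine (hx s).trans_eq ?_
  by_cases hr : M.Reach π s₀ x
  · have key : ∀ y, M.Reach π x y → h y = h x := by
      intro y hxy
      induction hxy with
      | refl => rfl
      | @tail y z hxy hyz ih =>
        have h1 := h0 y
        have hry : M.Reach π s₀ y := Relation.ReflTransGen.trans hr hxy
        rw [generator, if_pos hry] at h1
        exact M.eq_of_nextMean_eq π hx (by linarith) hyz
    exact (key s₀ (hback x hr)).symm
  · have h1 := h0 x
    rw [generator, if_neg hr] at h1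
    linarith

theorem nextMean_add (M : MDP S A) (π : S → A) (g h : S → ℝ) (s : S) :
    M.nextMean π (g + h) s = M.nextMean π g s + M.nextMean π h s := by
  simp [nextMean, mul_add, Finset.sum_add_distrib]

theorem nextMean_smul (M : MDP S A) (π : S → A) (c : ℝ) (h : S → ℝ) (s : S) :
    M.nextMean π (c • h) s = c * M.nextMean π h s := by
  simp only [nextMean, Finset.mul_sum, Pi.smul_apply, smul_eq_mul]
  exact Finset.sum_congr rfl fun _ _ => by ring

theorem generator_smul (M : MDP S A) (π : S → A) (s₀ : S) (c : ℝ) (h : S → ℝ) (s : S) :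
    M.generator π s₀ (c • h) s = c * M.generator π s₀ h s := by
  unfold generator
  split_ifs <;> simp [nextMean_smul] <;> ring

theorem generator_add (M : MDP S A) (π : S → A) (s₀ : S) (g h : S → ℝ) (s : S) :
    M.generator π s₀ (g + h) s = M.generator π s₀ g s + M.generator π s₀ h s := by
  unfold generator
  split_ifs <;> simp [nextMean_add] <;> ring

/-- The linear map `(h, c) ↦ (h - P h + c, h s₀)`. -/
noncomputable def poissonMap (M : MDP S A) (π : S → A) (s₀ : S) :
    ((S → ℝ) × ℝ) →ₗ[ℝ] ((S → ℝ) × ℝ) where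
  toFun p := (fun s => M.generator π s₀ p.1 s + p.2, p.1 s₀)
  map_add' p q := by
    ext
    · simp [generator_add]; ring
    · simp
  map_smul' c p := by
    ext
    · simp [generator_smul]; ring
    · simp

/-- On the kernel the generator of `h` is the constant `-c`. Its sign at a maximum and at a minimum
of `h` gives `c = 0`; the maximum principle for `h` and `-h` then makes `h` constant, and the
normalisation `h s₀ = 0` kills it. Redirecting unreachable states to `s₀` prevents other recurrent
classes from enlarging the kernel. -/
theorem poissonMap_injective (M : MDP S A) (π : S → A) {s₀ : S}
    (hback : ∀ s, M.Reach π s₀ s → M.Reach π s s₀) :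
    Function.Injective (M.poissonMap π s₀) := by
  rw [injective_iff_map_eq_zero]
  rintro ⟨h, c⟩ hp
  have hgen : ∀ s, M.generator π s₀ h s + c = 0 := fun s => congrFun (congrArg Prod.fst hp) s
  have h0 : h s₀ = 0 := congrArg Prod.snd hp
  have hneg : ∀ s, M.generator π s₀ (-h) s = -M.generator π s₀ h s := fun s => by
    rw [← neg_one_smul ℝ h, generator_smul]; ring
  have : Nonempty S := ⟨s₀⟩
  have hc : c = 0 := by
    obtain ⟨x, hx⟩ := Finite.exists_max h
    obtain ⟨y, hy⟩ := Finite.exists_max (-h)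
    have h1 := M.generator_nonneg_of_max π (s₀ := s₀) hx
    have h2 := M.generator_nonneg_of_max π (s₀ := s₀) hy
    rw [hneg] at h2
    linarith [hgen x, hgen y]
  subst hc
  have h1 := M.le_of_generator_eq_zero π (h := h) hback fun s => by linarith [hgen s]
  have h2 := M.le_of_generator_eq_zero π (h := -h) hback fun s => by linarith [hgen s, hneg s]
  ext s
  · have h3 := h1 s
    have h4 := h2 s
    simp only [Pi.neg_apply, neg_le_neg_iff] at h4
    change h s = 0
    linarith
  · rfl

/-- Solvability of the Poisson equation on the class of a recurrent state. -/
theorem exists_poisson (M : MDP S A) (π : S → A) {s₀ : S}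
    (hback : ∀ s, M.Reach π s₀ s → M.Reach π s s₀) (f : S → ℝ) :
    ∃ (c : ℝ) (h : S → ℝ), ∀ s, M.Reach π s₀ s → f s + M.nextMean π h s - h s = c := by
  obtain ⟨⟨h, c⟩, hp⟩ :=
    LinearMap.injective_iff_surjective.1 (M.poissonMap_injective π hback) (f, 0)
  refine ⟨c, h, fun s hs => ?_⟩
  have h1 : M.generator π s₀ h s + c = f s := congrFun (congrArg Prod.fst hp) s
  rw [generator, if_pos hs] at h1
  linarith

end Reach

/-! ### Excursions from a recurrent state. -/

section Excursion

variable {S : Type*}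

open Classical in
/-- Indicator of being at `s` at time `n` without having returned to `s₀`. -/
noncomputable def excursionAt (s₀ s : S) (n : ℕ) (ω : ℕ → S) : ℝ :=
  if (∀ k, 1 ≤ k → k ≤ n → ω k ≠ s₀) ∧ ω n = s then 1 else 0

theorem dependsOn_excursionAt (s₀ s : S) (n : ℕ) :
    DependsOn (excursionAt s₀ s n) (Set.Iic n) := by
  intro x y hxy
  have h1 : (∀ k, 1 ≤ k → k ≤ n → x k ≠ s₀) ↔ ∀ k, 1 ≤ k → k ≤ n → y k ≠ s₀ :=
    forall_congr' fun k => forall_congr' fun _ => forall_congr' fun hk => by rw [hxy k hk]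
  unfold excursionAt
  rw [h1, hxy n Set.self_mem_Iic]

theorem excursionAt_nonneg (s₀ s : S) (n : ℕ) (ω : ℕ → S) : 0 ≤ excursionAt s₀ s n ω := by
  unfold excursionAt; split_ifs <;> norm_num

end Excursion

section Recurrence

variable {S A : Type*} [Fintype S] [MeasurableSpace S] [DiscreteMeasurableSpace S]

theorem ae_law_reach (M : MDP S A) (π : S → A) (s₀ : S) :
    ∀ᵐ ω ∂(M.law π s₀), ∀ n, M.Reach π s₀ (ω n) := by
  filter_upwards [M.ae_law_zero π s₀, M.ae_law_transition π s₀] with ω h0 h n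
  induction n with
  | zero => rw [h0]; exact Relation.ReflTransGen.refl
  | succ n ih => exact ih.tail (h n)

/-- Induction along a path of positive probability: a step into `s₀` restarts the excursion at time
`0`, and any other step prolongs it. -/
theorem exists_integral_excursionAt_pos (M : MDP S A) (π : S → A) {s₀ s : S}
    (hs : M.Reach π s₀ s) : ∃ n, 0 < ∫ ω, excursionAt s₀ s n ω ∂(M.law π s₀) := by
  classical
  have hzero : 0 < ∫ ω, excursionAt s₀ s₀ 0 ω ∂(M.law π s₀) := by
    have : ∀ᵐ ω ∂(M.law π s₀), excursionAt s₀ s₀ 0 ω = 1 := by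
      filter_upwards [M.ae_law_zero π s₀] with ω hω
      rw [excursionAt, if_pos ⟨fun k h1 h2 => by omega, hω⟩]
    rw [integral_congr_ae this]
    simp
  induction hs with
  | refl => exact ⟨0, hzero⟩
  | @tail s s' _ hss' ih =>
    obtain ⟨n, hn⟩ := ih
    by_cases hs' : s' = s₀
    · exact ⟨0, hs' ▸ hzero⟩
    refine ⟨n + 1, ?_⟩
    have h1 := M.integral_mul_step π s₀ (dependsOn_excursionAt s₀ s n)
      (fun _ y => if y = s' then 1 else 0)
    have h2 : ∫ ω, excursionAt s₀ s n ω *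
        M.stepMean π (fun _ y => if y = s' then 1 else 0) (ω n) ∂(M.law π s₀) =
        (∫ ω, excursionAt s₀ s n ω ∂(M.law π s₀)) * M.P (π s) s s' := by
      rw [← integral_mul_const]
      congr 1
      ext ω
      by_cases hω : ω n = s
      · simp [stepMean, hω]
      · simp [excursionAt, hω]
    rw [h2] at h1
    refine (mul_pos hn hss').trans_le (h1.symm.le.trans ?_)
    refine integral_mono ?_ (integrable_of_dependsOn _ (dependsOn_excursionAt s₀ s' (n + 1))) ?_
    · refine integrable_of_dependsOn (n := n + 1) _ fun x y hxy => ?_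
      rw [dependsOn_excursionAt s₀ s n fun i hi => hxy i (Set.Iic_subset_Iic.2 n.le_succ hi),
        hxy (n + 1) Set.self_mem_Iic]
    · intro ω
      dsimp only
      by_cases hω : ω (n + 1) = s'
      · rw [if_pos hω, mul_one]
        unfold excursionAt
        split_ifs with ha hb
        · exact le_rfl
        · refine absurd ⟨fun k h1 h2 => ?_, hω⟩ hb
          rcases Nat.le_succ_iff.1 h2 with h3 | rfl
          · exact ha.1 k h1 h3
          · exact hω ▸ hs'
        · norm_num
        · norm_num
      · rw [if_neg hω, mul_zero]
        exact excursionAt_nonneg _ _ _ _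

/-- If the chain almost surely returns to `s₀`, then every state that is reachable from `s₀`
leads back to `s₀`. -/
theorem reach_of_ae_return (M : MDP S A) (π : S → A) {s₀ : S}
    (hret : ∀ᵐ ω ∂(M.law π s₀), ∃ t : ℕ, 1 ≤ t ∧ ω t = s₀) {s : S} (hs : M.Reach π s₀ s) :
    M.Reach π s s₀ := by
  by_contra hns
  obtain ⟨n, hn⟩ := M.exists_integral_excursionAt_pos π hs
  refine hn.ne' (integral_eq_zero_of_ae ?_)
  filter_upwards [hret, M.ae_law_transition π s₀] with ω ⟨t, ht1, ht⟩ hω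
  refine if_neg ?_
  rintro ⟨h1, rfl⟩
  -- A return by time `n` contradicts the excursion; a later one would make `s₀` reachable from `ω
  -- n`.
  rcases le_total t n with htn | hnt
  · exact h1 t ht1 htn ht
  · have hreach : ∀ k, n ≤ k → M.Reach π (ω n) (ω k) := by
      intro k hk
      induction k, hk using Nat.le_induction with
      | base => exact Relation.ReflTransGen.refl
      | succ k hk ih => exact ih.tail (hω k)
    exact hns (ht ▸ hreach t hnt)

end Recurrence

end MDP

/-! ### Strong law of large numbers for the transitions. -/

/-- Nonnegative functions with summable integrals are almost everywhere summable. -/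
theorem ae_summable_of_summable_integral {α : Type*} [MeasurableSpace α] {μ : Measure α}
    {f : ℕ → α → ℝ} (hf : ∀ n, Integrable (f n) μ) (h0 : ∀ n x, 0 ≤ f n x)
    (hs : Summable fun n => ∫ x, f n x ∂μ) : ∀ᵐ x ∂μ, Summable fun n => f n x := by
  have hmeas : ∀ n, AEMeasurable (fun x => ENNReal.ofReal (f n x)) μ :=
    fun n => (hf n).1.aemeasurable.ennreal_ofReal
  have hlt : ∫⁻ x, ∑' n, ENNReal.ofReal (f n x) ∂μ ≠ ⊤ := by
    rw [lintegral_tsum hmeas]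
    simp_rw [← ofReal_integral_eq_lintegral_ofReal (hf _) (ae_of_all _ (h0 _))]
    exact hs.tsum_ofReal_ne_top
  filter_upwards [ae_lt_top' (AEMeasurable.tsum hmeas) hlt] with x hx
  have := ENNReal.summable_toReal hx.ne
  simpa only [ENNReal.toReal_ofReal (h0 _ x)] using this

/-- A sequence with bounded increments that is sublinear along the squares is sublinear. -/
theorem tendsto_div_of_tendsto_sq {x : ℕ → ℝ} {C : ℝ} (hC : ∀ n, |x (n + 1) - x n| ≤ C)
    (hx : Tendsto (fun n : ℕ => x (n ^ 2) / (n : ℝ) ^ 2) atTop (𝓝 0)) :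
    Tendsto (fun n : ℕ => x n / n) atTop (𝓝 0) := by
  have hC0 : 0 ≤ C := (abs_nonneg _).trans (hC 0)
  have hinc : ∀ m k, |x (m + k) - x m| ≤ C * k := by
    intro m k
    induction k with
    | zero => simp
    | succ k ih =>
      have := abs_add_le (x (m + k + 1) - x (m + k)) (x (m + k) - x m)
      rw [sub_add_sub_cancel] at this
      push_cast
      rw [← add_assoc]
      linarith [hC (m + k)]
  have hsqrt : Tendsto Nat.sqrt atTop atTop := by
    refine tendsto_atTop.2 fun b => ?_
    filter_upwards [eventually_ge_atTop (b ^ 2)] with n hn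
    exact Nat.le_sqrt'.2 hn
  have hlim : Tendsto (fun m : ℕ => |x (m ^ 2) / (m : ℝ) ^ 2| + 2 * C / m) atTop (𝓝 0) := by
    simpa using hx.abs.add (tendsto_const_div_atTop_nhds_zero_nat (2 * C))
  refine squeeze_zero_norm' ?_ (hlim.comp hsqrt)
  filter_upwards [eventually_ge_atTop 1] with n hn
  set m := Nat.sqrt n
  have hm1 : 1 ≤ m := Nat.le_sqrt'.2 (by simpa using hn)
  have hm2 : m ^ 2 ≤ n := Nat.sqrt_le' n
  obtain ⟨k, hk⟩ := Nat.exists_eq_add_of_le hm2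
  -- Consecutive squares differ by `2 * m + 1`, so filling the gap costs at most `2 * C * m`,
  -- negligible against `m ^ 2`.
  have hk2 : k ≤ 2 * m := by
    have : n < (m + 1) ^ 2 := Nat.lt_succ_sqrt' n
    nlinarith
  have hmpos : (0 : ℝ) < m := by exact_mod_cast hm1
  have hnm : (m : ℝ) ^ 2 ≤ n := by exact_mod_cast hm2
  have hnpos : (0 : ℝ) < n := by exact_mod_cast hn
  have hkm : (k : ℝ) ≤ 2 * m := by exact_mod_cast hk2
  have h1 : |x n| ≤ |x (m ^ 2)| + C * k := by
    have h2 := hinc (m ^ 2) k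
    rw [← hk] at h2
    linarith [abs_sub_abs_le_abs_sub (x n) (x (m ^ 2))]
  rw [Real.norm_eq_abs, abs_div, abs_of_pos hnpos, Function.comp_apply, abs_div,
    abs_of_pos (pow_pos hmpos 2)]
  calc |x n| / n ≤ (|x (m ^ 2)| + C * k) / (m : ℝ) ^ 2 := by gcongr
    _ ≤ (|x (m ^ 2)| + C * (2 * m)) / (m : ℝ) ^ 2 := by gcongr
    _ = |x (m ^ 2)| / (m : ℝ) ^ 2 + 2 * C / m := by field_simp

namespace MDP

section Poisson

variable {S A : Type*} [Fintype S]

/-- The Poisson equation says exactly that this compensated functional is centred. -/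
theorem stepMean_poisson (M : MDP S A) (π : S → A) (φ : S → S → ℝ) (h : S → ℝ) (c : ℝ) (s : S) :
    M.stepMean π (fun s s' => φ s s' - c + (h s' - h s)) s =
      M.stepMean π φ s + M.nextMean π h s - h s - c := by
  simp only [stepMean, nextMean, mul_add, mul_sub, Finset.sum_add_distrib, Finset.sum_sub_distrib]
  rw [← Finset.sum_mul, ← Finset.sum_mul, M.P_sum]
  ring

end Poisson

section StrongLaw

variable {S A : Type*} [Fintype S] [MeasurableSpace S] [DiscreteMeasurableSpace S]

theorem dependsOn_sum_step {S : Type*} (φ : S → S → ℝ) (T : ℕ) :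
    DependsOn (fun ω : ℕ → S => ∑ t ∈ Finset.range T, φ (ω t) (ω (t + 1))) (Set.Iic T) := by
  intro x y hxy
  refine Finset.sum_congr rfl fun t ht => ?_
  have := Finset.mem_range.1 ht
  rw [hxy t (Set.mem_Iic.2 (by omega)), hxy (t + 1) (Set.mem_Iic.2 (by omega))]

theorem dependsOn_step {S : Type*} (φ : S → S → ℝ) (n : ℕ) :
    DependsOn (fun ω : ℕ → S => φ (ω n) (ω (n + 1))) (Set.Iic (n + 1)) := by
  intro x y hxy
  dsimp only
  rw [hxy n (Set.mem_Iic.2 n.le_succ), hxy (n + 1) Set.self_mem_Iic]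

/-- Increments are orthogonal: by the Markov property the new one is averaged to zero against the
past, so second moments add. -/
theorem integral_sq_sum_step_le (M : MDP S A) (π : S → A) (s₀ : S) {φ : S → S → ℝ} {C : ℝ}
    (hC : ∀ s s', |φ s s'| ≤ C) (h0 : ∀ s, M.Reach π s₀ s → M.stepMean π φ s = 0) (T : ℕ) :
    ∫ ω, (∑ t ∈ Finset.range T, φ (ω t) (ω (t + 1))) ^ 2 ∂(M.law π s₀) ≤ T * C ^ 2 := by
  induction T with
  | zero => simp
  | succ T ih =>
    have hsum := dependsOn_sum_step φ T
    have hstep := dependsOn_step φ T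
    have hsum' : DependsOn (fun ω : ℕ → S => ∑ t ∈ Finset.range T, φ (ω t) (ω (t + 1)))
      (Set.Iic (T + 1)) := fun x y hxy => hsum fun i hi => hxy i (Set.Iic_subset_Iic.2 T.le_succ hi)
    have i1 : Integrable (fun ω : ℕ → S =>
        (∑ t ∈ Finset.range T, φ (ω t) (ω (t + 1))) ^ 2) (M.law π s₀) :=
      integrable_of_dependsOn (n := T) _ fun x y hxy => congrArg (· ^ 2) (hsum hxy)
    have i2 : Integrable (fun ω : ℕ → S => (∑ t ∈ Finset.range T, φ (ω t) (ω (t + 1))) *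
        φ (ω T) (ω (T + 1))) (M.law π s₀) :=
      integrable_of_dependsOn (n := T + 1) _ fun x y hxy => congrArg₂ (· * ·) (hsum' hxy) (hstep hxy)
    have i3 : Integrable (fun ω : ℕ → S => φ (ω T) (ω (T + 1)) ^ 2) (M.law π s₀) :=
      integrable_of_dependsOn (n := T + 1) _ fun x y hxy => congrArg (· ^ 2) (hstep hxy)
    have hcross : ∫ ω, (∑ t ∈ Finset.range T, φ (ω t) (ω (t + 1))) *
        φ (ω T) (ω (T + 1)) ∂(M.law π s₀) = 0 := by
      rw [M.integral_mul_step π s₀ hsum]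
      refine integral_eq_zero_of_ae ?_
      filter_upwards [M.ae_law_reach π s₀] with ω hω
      rw [h0 _ (hω T), mul_zero, Pi.zero_apply]
    have hlast : ∫ ω, φ (ω T) (ω (T + 1)) ^ 2 ∂(M.law π s₀) ≤ C ^ 2 := by
      calc ∫ ω, φ (ω T) (ω (T + 1)) ^ 2 ∂(M.law π s₀) ≤ ∫ _, C ^ 2 ∂(M.law π s₀) :=
            integral_mono i3 (integrable_const _) fun ω =>
              sq_le_sq' (by linarith [(abs_le.1 (hC (ω T) (ω (T + 1)))).1])
                (abs_le.1 (hC (ω T) (ω (T + 1)))).2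
        _ = C ^ 2 := by simp
    have hexp : ∀ ω : ℕ → S, (∑ t ∈ Finset.range (T + 1), φ (ω t) (ω (t + 1))) ^ 2 =
        (∑ t ∈ Finset.range T, φ (ω t) (ω (t + 1))) ^ 2 +
          2 * ((∑ t ∈ Finset.range T, φ (ω t) (ω (t + 1))) * φ (ω T) (ω (T + 1))) +
          φ (ω T) (ω (T + 1)) ^ 2 := fun ω => by
      rw [Finset.sum_range_succ]; ring
    have i12 : Integrable (fun ω : ℕ → S => (∑ t ∈ Finset.range T, φ (ω t) (ω (t + 1))) ^ 2 +
        2 * ((∑ t ∈ Finset.range T, φ (ω t) (ω (t + 1))) * φ (ω T) (ω (T + 1)))) (M.law π s₀) :=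
      i1.add (i2.const_mul 2)
    simp_rw [hexp]
    rw [integral_add i12 i3, integral_add i1 (i2.const_mul 2),
      integral_const_mul, hcross]
    push_cast
    linarith

/-- Strong law for sums of centred functionals of the transitions. -/
theorem ae_tendsto_sum_step_div (M : MDP S A) (π : S → A) (s₀ : S) {φ : S → S → ℝ}
    (h0 : ∀ s, M.Reach π s₀ s → M.stepMean π φ s = 0) :
    ∀ᵐ ω ∂(M.law π s₀), Tendsto
      (fun T : ℕ => (∑ t ∈ Finset.range T, φ (ω t) (ω (t + 1))) / T) atTop (𝓝 0) := by
  obtain ⟨C, hC⟩ : ∃ C, ∀ s s', |φ s s'| ≤ C := by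
    obtain ⟨C, hC⟩ := Finite.exists_le fun p : S × S => |φ p.1 p.2|
    exact ⟨C, fun s s' => hC (s, s')⟩
  set f : ℕ → (ℕ → S) → ℝ := fun n ω =>
    ((∑ t ∈ Finset.range (n ^ 2), φ (ω t) (ω (t + 1))) / (n : ℝ) ^ 2) ^ 2 with hf
  have hint : ∀ n, Integrable (f n) (M.law π s₀) := fun n =>
    integrable_of_dependsOn (n := n ^ 2) _ fun x y hxy =>
      congrArg (fun z => (z / (n : ℝ) ^ 2) ^ 2) (dependsOn_sum_step φ (n ^ 2) hxy)
  -- The sum up to `n ^ 2` has second moment at most `n ^ 2 * C ^ 2`, which is divided by `n ^ 4`.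
  have hle : ∀ n, ∫ ω, f n ω ∂(M.law π s₀) ≤ C ^ 2 * (1 / (n : ℝ) ^ 2) := by
    intro n
    have h1 := M.integral_sq_sum_step_le π s₀ hC h0 (n ^ 2)
    simp only [hf, div_pow]
    rw [integral_div]
    rcases Nat.eq_zero_or_pos n with rfl | hn
    · simp
    have hn' : (0 : ℝ) < n := by exact_mod_cast hn
    rw [div_le_iff₀ (by positivity)]
    refine h1.trans_eq ?_
    push_cast
    field_simp
  have hsum : Summable fun n => ∫ ω, f n ω ∂(M.law π s₀) :=
    Summable.of_nonneg_of_le (fun n => integral_nonneg fun ω => sq_nonneg _) hle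
      ((Real.summable_one_div_nat_pow.2 one_lt_two).mul_left _)
  filter_upwards [ae_summable_of_summable_integral hint (fun n ω => sq_nonneg _) hsum] with ω hω
  refine tendsto_div_of_tendsto_sq (C := C) (fun n => ?_) ?_
  · rw [Finset.sum_range_succ, add_sub_cancel_left]
    exact hC _ _
  · have h1 := hω.tendsto_atTop_zero
    have h2 := h1.sqrt
    simp only [hf, Real.sqrt_sq_eq_abs, Real.sqrt_zero] at h2
    exact (tendsto_zero_iff_abs_tendsto_zero _).2 h2

/-- Ergodic theorem: the time average of a functional of the transitions converges to the constant
of its Poisson equation. -/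
theorem ae_tendsto_average (M : MDP S A) (π : S → A) (s₀ : S) {φ : S → S → ℝ} {h : S → ℝ} {c : ℝ}
    (hc : ∀ s, M.Reach π s₀ s → M.stepMean π φ s + M.nextMean π h s - h s = c) :
    ∀ᵐ ω ∂(M.law π s₀), Tendsto
      (fun T : ℕ => (∑ t ∈ Finset.range T, φ (ω t) (ω (t + 1))) / T) atTop (𝓝 c) := by
  obtain ⟨B, hB⟩ := Finite.exists_le fun s => |h s|
  filter_upwards [M.ae_tendsto_sum_step_div π s₀
    (φ := fun s s' => φ s s' - c + (h s' - h s)) fun s hs => by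
      rw [stepMean_poisson, hc s hs, sub_self]] with ω hω
  have hbdd : Tendsto (fun T : ℕ => (h (ω T) - h (ω 0)) / T) atTop (𝓝 0) := by
    refine squeeze_zero_norm (fun T => ?_) (tendsto_const_div_atTop_nhds_zero_nat (2 * B))
    rw [norm_div, Real.norm_eq_abs, Real.norm_natCast]
    gcongr
    linarith [abs_sub (h (ω T)) (h (ω 0)), hB (ω T), hB (ω 0)]
  have hlim := (hω.sub hbdd).add_const c
  rw [sub_zero, zero_add] at hlim
  refine hlim.congr' ?_
  filter_upwards [eventually_ge_atTop 1] with T hT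
  have hT' : (T : ℝ) ≠ 0 := by positivity
  rw [Finset.sum_add_distrib, Finset.sum_sub_distrib, Finset.sum_range_sub (fun t => h (ω t)),
    Finset.sum_const, Finset.card_range, nsmul_eq_mul]
  field_simp
  ring

end StrongLaw

end MDP

theorem integrable_tsum_of_summable_integral_norm {α : Type*} [MeasurableSpace α] {μ : Measure α}
    {f : ℕ → α → ℝ} (hf : ∀ n, Integrable (f n) μ)
    (hs : Summable fun n => ∫ x, ‖f n x‖ ∂μ) : Integrable (fun x => ∑' n, f n x) μ := by
  refine ⟨(AEMeasurable.tsum fun n => (hf n).1.aemeasurable).aestronglyMeasurable, ?_⟩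
  refine lt_of_le_of_lt (lintegral_mono fun x => enorm_tsum_le_tsum_enorm) ?_
  rw [lintegral_tsum fun n => (hf n).1.enorm]
  simp_rw [← ofReal_norm,
    ← ofReal_integral_eq_lintegral_ofReal (hf _).norm (ae_of_all _ fun _ => norm_nonneg _)]
  exact hs.tsum_ofReal_ne_top.lt_top

/-! ### The probabilistic-termination process. -/

namespace MDP

/-- The termination probability of a transition of difficulty `d` is `d / H`, up to a relative
error of order `1 / H`. -/
theorem abs_sub_mul_one_sub_contProb_le {H d Dmax : ℝ} (hH : 1 < H) (hd : 0 ≤ d) (hdD : d ≤ Dmax) :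
    |d - H * (1 - contProb H d)| ≤ (1 + Dmax) * (1 - contProb H d) := by
  have hH0 : 0 < H := by linarith
  have hγ : 0 < 1 - 1 / H := by
    rw [sub_pos, div_lt_one hH0]; exact hH
  have hg1 := contProb_le_one hH hd
  have hg0 := contProb_nonneg hH d
  have hexp : contProb H d = Real.exp (Real.log (1 - 1 / H) * d) := Real.rpow_def_of_pos hγ d
  -- Upper half, from `log x ≤ x - 1`; the error is `d * (1 - contProb H d)`, whence the `Dmax` in
  -- the constant.
  have hup : d ≤ (H + d) * (1 - contProb H d) := by
    have hlog : Real.log (1 - 1 / H) ≤ -(1 / H) := by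
      linarith [Real.log_le_sub_one_of_pos hγ]
    have h1 : 1 + d / H ≤ Real.exp (-(Real.log (1 - 1 / H) * d)) := by
      have h2 : d / H ≤ -(Real.log (1 - 1 / H) * d) := by
        have := mul_le_mul_of_nonneg_right hlog hd
        have h3 : -(1 / H) * d = -(d / H) := by ring
        linarith
      linarith [Real.add_one_le_exp (-(Real.log (1 - 1 / H) * d))]
    have h2 : contProb H d * (1 + d / H) ≤ 1 := by
      calc contProb H d * (1 + d / H) ≤
            contProb H d * Real.exp (-(Real.log (1 - 1 / H) * d)) := by gcongr
        _ = 1 := by rw [hexp, ← Real.exp_add]; simp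
    have h3 : contProb H d * (H + d) ≤ H := by
      calc contProb H d * (H + d) = (contProb H d * (1 + d / H)) * H := by field_simp
        _ ≤ 1 * H := by gcongr
        _ = H := one_mul H
    linarith
  -- Lower half, from `log x ≥ 1 - x⁻¹`; this accounts for the `1` in the constant.
  have hlow : (H - 1) * (1 - contProb H d) ≤ d := by
    have hlog := Real.one_sub_inv_le_log_of_pos hγ
    have hinv : 1 - (1 - 1 / H)⁻¹ = -(1 / (H - 1)) := by
      have : H - 1 ≠ 0 := by linarith
      have h1 : 1 - 1 / H = (H - 1) / H := by field_simp
      rw [h1, inv_div]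
      field_simp
      ring
    rw [hinv] at hlog
    have h1 := Real.add_one_le_exp (Real.log (1 - 1 / H) * d)
    rw [← hexp] at h1
    have h2 := mul_le_mul_of_nonneg_right hlog hd
    have h3 : 1 - contProb H d ≤ 1 / (H - 1) * d := by linarith
    have h4 : 0 < H - 1 := by linarith
    calc (H - 1) * (1 - contProb H d) ≤ (H - 1) * (1 / (H - 1) * d) := by gcongr
      _ = d := by field_simp
  have h5 : d * (1 - contProb H d) ≤ Dmax * (1 - contProb H d) :=
    mul_le_mul_of_nonneg_right hdD (by linarith)
  have h6 : 0 ≤ Dmax * (1 - contProb H d) := mul_nonneg (hd.trans hdD) (by linarith)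
  rw [abs_le]
  constructor <;> nlinarith

section Reach

variable {S A : Type*} [Fintype S]

theorem stepMean_ptMDP_true (M : MDP S A) (π : S → A) {H : ℝ} (hH : 1 < H)
    (φ : S × Bool → S × Bool → ℝ) (s : S) :
    (M.ptMDP H hH).stepMean (ptPolicy π) φ (s, true) =
      M.stepMean π (fun s s' => contProb H (M.D (π s) s s') * φ (s, true) (s', true) +
        (1 - contProb H (M.D (π s) s s')) * φ (s, true) (s', false)) s := by
  unfold stepMean
  rw [Fintype.sum_prod_type]
  refine Finset.sum_congr rfl fun s' _ => ?_
  rw [Fintype.sum_bool]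
  simp only [ptMDP, ptPolicy]
  ring

theorem stepMean_ptMDP_false (M : MDP S A) (π : S → A) {H : ℝ} (hH : 1 < H)
    (φ : S × Bool → S × Bool → ℝ) (s : S) :
    (M.ptMDP H hH).stepMean (ptPolicy π) φ (s, false) = φ (s, false) (s, false) := by
  simp [stepMean, ptMDP]

/-- A transition either stays put or projects to one of the original chain, so Poisson equations
valid on the original class apply along the terminating process. -/
theorem reach_of_ptMDP_reach (M : MDP S A) (π : S → A) {H : ℝ} (hH : 1 < H) {x y : S × Bool}
    (h : (M.ptMDP H hH).Reach (ptPolicy π) x y) : M.Reach π x.1 y.1 := by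
  induction h with
  | refl => exact Relation.ReflTransGen.refl
  | @tail y z _ hyz ih =>
    obtain ⟨s, b⟩ := y
    obtain ⟨s', b'⟩ := z
    cases b with
    | false =>
      have h1 : (s', b') = (s, false) := by
        by_contra hne
        simp [ptMDP, hne] at hyz
      rw [(Prod.mk.inj h1).1]
      exact ih
    | true =>
      refine ih.tail ((M.P_nonneg _ _ _).lt_of_ne fun h0 => ?_)
      cases b' <;> simp [ptMDP, ptPolicy, ← h0] at hyz

end Reach

section PT

variable {S A : Type*} [Fintype S] [MeasurableSpace S] [DiscreteMeasurableSpace S]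

instance (M : MDP S A) (π : S → A) (s₀ : S) (H : ℝ) (hH : 1 < H) :
    IsProbabilityMeasure (M.ptLaw π s₀ H hH) := by
  unfold ptLaw; infer_instance

theorem integrable_eval (μ : Measure (ℕ → S)) [IsFiniteMeasure μ] (f : S → ℝ) (n : ℕ) :
    Integrable (fun ω => f (ω n)) μ :=
  integrable_of_dependsOn (n := n) μ fun x y hxy => by rw [hxy n Set.self_mem_Iic]

theorem ae_ptLaw_reach (M : MDP S A) (π : S → A) (s₀ : S) {H : ℝ} (hH : 1 < H) :
    ∀ᵐ ω ∂(M.ptLaw π s₀ H hH), ∀ n, M.Reach π s₀ (ω n).1 := by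
  filter_upwards [(M.ptMDP H hH).ae_law_reach (ptPolicy π) (s₀, true)] with ω hω n
  exact M.reach_of_ptMDP_reach π hH (hω n)

/-- Once stopped, the probabilistic-termination process stays stopped. -/
theorem ae_ptLaw_absorbing (M : MDP S A) (π : S → A) (s₀ : S) {H : ℝ} (hH : 1 < H) :
    ∀ᵐ ω ∂(M.ptLaw π s₀ H hH), ∀ m n, m ≤ n → (ω m).2 = false → (ω n).2 = false := by
  filter_upwards [(M.ptMDP H hH).ae_law_transition (ptPolicy π) (s₀, true)] with ω hω m n hmn hm
  induction n, hmn using Nat.le_induction with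
  | base => exact hm
  | succ n _ ih =>
    have h := hω n
    generalize ω n = x at h ih
    generalize ω (n + 1) = y at h
    obtain ⟨s, b⟩ := x
    obtain rfl : b = false := ih
    have hy : y = (s, false) := by
      by_contra hne
      simp [ptMDP, hne] at h
    rw [hy]

/-- Mean of `f` over the state at time `t`, on the event that the process has not yet stopped. -/
noncomputable def aliveMean (M : MDP S A) (π : S → A) (s₀ : S) (H : ℝ) (hH : 1 < H) (t : ℕ)
    (f : S → ℝ) : ℝ :=
  ∫ ω, (if (ω t).2 = true then f (ω t).1 else 0) ∂(M.ptLaw π s₀ H hH)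

variable (M : MDP S A) (π : S → A) (s₀ : S) {H : ℝ} (hH : 1 < H)

theorem integrable_alive (t : ℕ) (f : S → ℝ) :
    Integrable (fun ω : ℕ → S × Bool => if (ω t).2 = true then f (ω t).1 else 0)
      (M.ptLaw π s₀ H hH) :=
  integrable_eval _ (fun x : S × Bool => if x.2 = true then f x.1 else 0) t

theorem aliveMean_mono (t : ℕ) {f g : S → ℝ} (hfg : ∀ s, M.Reach π s₀ s → f s ≤ g s) :
    M.aliveMean π s₀ H hH t f ≤ M.aliveMean π s₀ H hH t g := by
  refine integral_mono_ae (M.integrable_alive π s₀ hH t f) (M.integrable_alive π s₀ hH t g) ?_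
  filter_upwards [M.ae_ptLaw_reach π s₀ hH] with ω hω
  split_ifs
  · exact hfg _ (hω t)
  · exact le_rfl

theorem aliveMean_congr (t : ℕ) {f g : S → ℝ} (hfg : ∀ s, M.Reach π s₀ s → f s = g s) :
    M.aliveMean π s₀ H hH t f = M.aliveMean π s₀ H hH t g :=
  le_antisymm (M.aliveMean_mono π s₀ hH t fun s hs => (hfg s hs).le)
    (M.aliveMean_mono π s₀ hH t fun s hs => (hfg s hs).ge)

theorem aliveMean_sub (t : ℕ) (f g : S → ℝ) :
    M.aliveMean π s₀ H hH t (fun s => f s - g s) =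
      M.aliveMean π s₀ H hH t f - M.aliveMean π s₀ H hH t g := by
  unfold aliveMean
  rw [← integral_sub (M.integrable_alive π s₀ hH t f) (M.integrable_alive π s₀ hH t g)]
  congr 1
  ext ω
  split_ifs <;> simp

theorem aliveMean_const_mul (t : ℕ) (c : ℝ) (f : S → ℝ) :
    M.aliveMean π s₀ H hH t (fun s => c * f s) = c * M.aliveMean π s₀ H hH t f := by
  unfold aliveMean
  rw [← integral_const_mul]
  congr 1
  ext ω
  split_ifs <;> simp

theorem aliveMean_one_nonneg (t : ℕ) : 0 ≤ M.aliveMean π s₀ H hH t fun _ => 1 :=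
  integral_nonneg fun ω => by dsimp only [Pi.zero_apply]; split_ifs <;> norm_num

/-- The continuation and termination weights add up to one, so a live step is averaged as in the
original chain. -/
theorem integral_alive_step (t : ℕ) (ψ : S → S → ℝ) :
    ∫ ω, (if (ω t).2 = true then ψ (ω t).1 (ω (t + 1)).1 else 0) ∂(M.ptLaw π s₀ H hH) =
      M.aliveMean π s₀ H hH t (M.stepMean π ψ) := by
  have h := (M.ptMDP H hH).integral_step (ptPolicy π) (s₀, true) t
    (fun x y => if x.2 = true then ψ x.1 y.1 else 0)
  refine h.trans (integral_congr_ae (ae_of_all _ fun ω => ?_))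
  dsimp only
  generalize ω t = x
  obtain ⟨s, _ | _⟩ := x
  · rw [stepMean_ptMDP_false]; simp
  · rw [stepMean_ptMDP_true]
    simp only [if_true]
    congr 1
    ext s s'
    ring

/-- Only live steps move the first coordinate, and termination does not affect where it moves.
Remembering that coordinate after stopping makes these increments telescope over all times. -/
theorem integral_succ_sub (t : ℕ) (h : S → ℝ) :
    ∫ ω, h (ω (t + 1)).1 ∂(M.ptLaw π s₀ H hH) - ∫ ω, h (ω t).1 ∂(M.ptLaw π s₀ H hH) =
      M.aliveMean π s₀ H hH t fun s => M.nextMean π h s - h s := by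
  rw [← integral_sub (integrable_eval _ (fun x : S × Bool => h x.1) (t + 1))
    (integrable_eval _ (fun x : S × Bool => h x.1) t)]
  refine ((M.ptMDP H hH).integral_step (ptPolicy π) (s₀, true) t
    (fun x y => h y.1 - h x.1)).trans (integral_congr_ae (ae_of_all _ fun ω => ?_))
  dsimp only
  generalize ω t = x
  obtain ⟨s, _ | _⟩ := x
  · rw [stepMean_ptMDP_false]; simp
  · rw [stepMean_ptMDP_true]
    have := M.stepMean_poisson π (fun _ _ => 0) h 0 s
    simp only [if_true]
    convert this using 1
    · congr 1
      ext s s'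
      ring
    · simp [stepMean]

theorem aliveMean_one_sub_succ (t : ℕ) :
    M.aliveMean π s₀ H hH t (fun _ => 1) - M.aliveMean π s₀ H hH (t + 1) (fun _ => 1) =
      M.aliveMean π s₀ H hH t (M.stepMean π fun s s' => 1 - contProb H (M.D (π s) s s')) := by
  unfold aliveMean
  rw [← integral_sub (M.integrable_alive π s₀ hH t fun _ => 1)
    (M.integrable_alive π s₀ hH (t + 1) fun _ => 1)]
  refine ((M.ptMDP H hH).integral_step (ptPolicy π) (s₀, true) t
    (fun x y => (if x.2 = true then 1 else 0) - if y.2 = true then 1 else 0)).trans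
    (integral_congr_ae (ae_of_all _ fun ω => ?_))
  dsimp only
  generalize ω t = x
  obtain ⟨s, _ | _⟩ := x
  · rw [stepMean_ptMDP_false]; simp
  · rw [stepMean_ptMDP_true]; simp

theorem integral_ptLaw_zero (f : S × Bool → ℝ) :
    ∫ ω, f (ω 0) ∂(M.ptLaw π s₀ H hH) = f (s₀, true) := by
  have : ∀ᵐ ω ∂(M.ptLaw π s₀ H hH), f (ω 0) = f (s₀, true) := by
    filter_upwards [(M.ptMDP H hH).ae_law_zero (ptPolicy π) (s₀, true)] with ω hω
    rw [hω]
  rw [integral_congr_ae this]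
  simp

/-- The probability of having stopped by time `T` is the sum of the termination probabilities. -/
theorem sum_aliveMean_one_sub_contProb (T : ℕ) :
    ∑ t ∈ Finset.range T, M.aliveMean π s₀ H hH t
        (M.stepMean π fun s s' => 1 - contProb H (M.D (π s) s s')) =
      1 - M.aliveMean π s₀ H hH T fun _ => 1 := by
  simp_rw [← aliveMean_one_sub_succ]
  rw [Finset.sum_range_sub' fun t => M.aliveMean π s₀ H hH t fun _ => 1]
  congr 1
  simpa [aliveMean] using M.integral_ptLaw_zero π s₀ hH fun x => if x.2 = true then 1 else 0

/-- Up to a bounded error, a functional of the transitions accumulates at the rate of the constant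
of its Poisson equation until the process stops. -/
theorem abs_sum_aliveMean_sub_le {φ : S → S → ℝ} {h : S → ℝ} {c B : ℝ}
    (hc : ∀ s, M.Reach π s₀ s → M.stepMean π φ s + M.nextMean π h s - h s = c)
    (hB : ∀ s, |h s| ≤ B) (T : ℕ) :
    |∑ t ∈ Finset.range T, M.aliveMean π s₀ H hH t (M.stepMean π φ) -
      c * ∑ t ∈ Finset.range T, M.aliveMean π s₀ H hH t fun _ => 1| ≤ 2 * B := by
  have hstep : ∀ t, M.aliveMean π s₀ H hH t (M.stepMean π φ) -
      c * M.aliveMean π s₀ H hH t (fun _ => 1) =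
      ∫ ω, h (ω t).1 ∂(M.ptLaw π s₀ H hH) - ∫ ω, h (ω (t + 1)).1 ∂(M.ptLaw π s₀ H hH) := by
    intro t
    have h1 := M.integral_succ_sub π s₀ hH t h
    have h2 : M.aliveMean π s₀ H hH t (M.stepMean π φ) =
        M.aliveMean π s₀ H hH t (fun s => c * 1 - (M.nextMean π h s - h s)) :=
      M.aliveMean_congr π s₀ hH t fun s hs => by linarith [hc s hs]
    rw [aliveMean_sub, aliveMean_const_mul] at h2
    linarith
  rw [Finset.mul_sum, ← Finset.sum_sub_distrib, Finset.sum_congr rfl fun t _ => hstep t,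
    Finset.sum_range_sub' fun t => ∫ ω, h (ω t).1 ∂(M.ptLaw π s₀ H hH)]
  have hbound : ∀ t, |∫ ω, h (ω t).1 ∂(M.ptLaw π s₀ H hH)| ≤ B := fun t => by
    have := norm_integral_le_of_norm_le_const (μ := M.ptLaw π s₀ H hH)
      (f := fun ω : ℕ → S × Bool => h (ω t).1) (C := B) (ae_of_all _ fun ω => hB _)
    simpa using this
  linarith [abs_sub (∫ ω, h (ω 0).1 ∂(M.ptLaw π s₀ H hH)) (∫ ω, h (ω T).1 ∂(M.ptLaw π s₀ H hH)),
    hbound 0, hbound T]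

/-- The expected difficulty accumulated by time `T` is `H` times the probability of having stopped,
up to a bounded error. -/
theorem abs_sum_difficulty_sub_le {Dmax : ℝ} (hD : ∀ a s s', M.D a s s' ≤ Dmax) (T : ℕ) :
    |∑ t ∈ Finset.range T, M.aliveMean π s₀ H hH t (M.stepMean π fun s s' => M.D (π s) s s') -
      H * (1 - M.aliveMean π s₀ H hH T fun _ => 1)| ≤
      (1 + Dmax) * (1 - M.aliveMean π s₀ H hH T fun _ => 1) := by
  set q : S → ℝ := M.stepMean π fun s s' => 1 - contProb H (M.D (π s) s s')
  set δ : S → ℝ := M.stepMean π fun s s' => M.D (π s) s s'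
  have hpt : ∀ s, |δ s - H * q s| ≤ (1 + Dmax) * q s := by
    intro s
    simp only [δ, q, stepMean, Finset.mul_sum, ← Finset.sum_sub_distrib]
    refine (Finset.abs_sum_le_sum_abs _ _).trans (Finset.sum_le_sum fun s' _ => ?_)
    have h1 := abs_sub_mul_one_sub_contProb_le hH (M.D_nonneg (π s) s s') (hD (π s) s s')
    have h2 := mul_le_mul_of_nonneg_left h1 (M.P_nonneg (π s) s s')
    rw [← abs_of_nonneg (M.P_nonneg (π s) s s'), ← abs_mul,
      abs_of_nonneg (M.P_nonneg (π s) s s')] at h2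
    calc _ = |M.P (π s) s s' * (M.D (π s) s s' - H * (1 - contProb H (M.D (π s) s s')))| := by
          congr 1; ring
      _ ≤ _ := h2
      _ = _ := by ring
  rw [← sum_aliveMean_one_sub_contProb, Finset.mul_sum, Finset.mul_sum, ← Finset.sum_sub_distrib]
  refine (Finset.abs_sum_le_sum_abs _ _).trans (Finset.sum_le_sum fun t _ => ?_)
  rw [← aliveMean_const_mul, ← aliveMean_const_mul, ← aliveMean_sub, abs_le,
    neg_eq_neg_one_mul, ← aliveMean_const_mul]
  exact ⟨M.aliveMean_mono π s₀ hH t fun s _ => by linarith [(abs_le.1 (hpt s)).1],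
    M.aliveMean_mono π s₀ hH t fun s _ => (abs_le.1 (hpt s)).2⟩

end PT

/-! ### Finiteness of the termination time and the expected total reward. -/

section Term

variable {S A : Type*} [Fintype S] [MeasurableSpace S] [DiscreteMeasurableSpace S]
  (M : MDP S A) (π : S → A) (s₀ : S) {H : ℝ} (hH : 1 < H)

/-- The expected termination time is finite if difficulty accumulates at a positive rate. -/
theorem summable_aliveMean_one {Dmax : ℝ} (hD : ∀ a s s', M.D a s s' ≤ Dmax) {h : S → ℝ} {c : ℝ}
    (hc : ∀ s, M.Reach π s₀ s →
      M.stepMean π (fun s s' => M.D (π s) s s') s + M.nextMean π h s - h s = c) (hc0 : 0 < c) :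
    Summable fun t => M.aliveMean π s₀ H hH t fun _ => 1 := by
  obtain ⟨B, hB⟩ := Finite.exists_le fun s => |h s|
  have hDmax : 0 ≤ Dmax := (M.D_nonneg (π s₀) s₀ s₀).trans (hD _ _ _)
  -- `c` times the expected number of live steps is at most the expected difficulty plus `2 * B`,
  -- and that difficulty is at most `H + (1 + Dmax)`.
  refine summable_of_sum_range_le (c := (2 * B + (H + (1 + Dmax))) / c)
    (M.aliveMean_one_nonneg π s₀ hH) fun T => ?_
  rw [le_div_iff₀ hc0]
  have h1 := (abs_le.1 (M.abs_sum_aliveMean_sub_le π s₀ hH hc hB T)).1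
  have h2 := (abs_le.1 (M.abs_sum_difficulty_sub_le π s₀ hH hD T)).2
  have h3 := M.aliveMean_one_nonneg π s₀ hH T
  have h4 : (H + (1 + Dmax)) * (1 - M.aliveMean π s₀ H hH T fun _ => 1) ≤ H + (1 + Dmax) :=
    mul_le_of_le_one_right (by linarith) (by linarith)
  linarith

theorem ae_ptLaw_exists_term (hs : Summable fun t => M.aliveMean π s₀ H hH t fun _ => 1) :
    ∀ᵐ ω ∂(M.ptLaw π s₀ H hH), ∃ t : ℕ, 1 ≤ t ∧ (ω t).2 = false := by
  filter_upwards [ae_summable_of_summable_integral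
    (fun t => M.integrable_alive π s₀ hH t fun _ => 1)
    (fun t ω => by split_ifs <;> norm_num) hs] with ω hω
  obtain ⟨t, ht, ht1⟩ := ((hω.tendsto_atTop_zero.eventually_lt_const one_pos).and
    (eventually_ge_atTop 1)).exists
  refine ⟨t, ht1, ?_⟩
  by_contra hne
  rw [if_pos (Bool.eq_true_of_not_eq_false hne)] at ht
  exact lt_irrefl _ ht

/-- The reward up to termination is the sum of the rewards of all transitions. -/
theorem ae_ptReward_eq_tsum (hs : Summable fun t => M.aliveMean π s₀ H hH t fun _ => 1) :
    ∀ᵐ ω ∂(M.ptLaw π s₀ H hH), M.ptReward π H hH ω =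
      ∑' t, if (ω t).2 = true then M.R (π (ω t).1) (ω t).1 (ω (t + 1)).1 else 0 := by
  filter_upwards [M.ae_ptLaw_exists_term π s₀ hH hs, M.ae_ptLaw_absorbing π s₀ hH] with ω hω habs
  have hterm : (ω (term ω)).2 = false := (Nat.sInf_mem hω).2
  -- Rewards are indexed by the departure state, so `range (term ω)` includes the terminating
  -- transition; later ones start from a stopped state and vanish.
  refine (tsum_eq_sum (s := Finset.range (term ω)) (L := .unconditional ℕ) fun t ht => ?_).symm
  have hdead := habs (term ω) t (by simpa using ht) hterm
  simp [ptMDP, hdead]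

theorem summable_integral_norm_reward {Rmax : ℝ} (hR : ∀ a s s', |M.R a s s'| ≤ Rmax)
    (hs : Summable fun t => M.aliveMean π s₀ H hH t fun _ => 1) :
    Summable fun t => ∫ ω, ‖if (ω t).2 = true then M.R (π (ω t).1) (ω t).1 (ω (t + 1)).1 else 0‖
      ∂(M.ptLaw π s₀ H hH) := by
  refine Summable.of_nonneg_of_le (fun t => integral_nonneg fun ω => norm_nonneg _) (fun t => ?_)
    (hs.mul_left Rmax)
  rw [aliveMean, ← integral_const_mul]
  refine integral_mono ?_ ((M.integrable_alive π s₀ hH t fun _ => 1).const_mul Rmax) fun ω => ?_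
  · exact integrable_of_dependsOn _ (dependsOn_step (fun x y : S × Bool =>
      ‖if x.2 = true then M.R (π x.1) x.1 y.1 else 0‖) t)
  · dsimp only
    split_ifs
    · simpa using hR _ _ _
    · simp

theorem integrable_alive_reward (t : ℕ) :
    Integrable (fun ω : ℕ → S × Bool =>
      if (ω t).2 = true then M.R (π (ω t).1) (ω t).1 (ω (t + 1)).1 else 0) (M.ptLaw π s₀ H hH) :=
  integrable_of_dependsOn _ (dependsOn_step (fun x y : S × Bool =>
    if x.2 = true then M.R (π x.1) x.1 y.1 else 0) t)

theorem integrable_ptReward {Rmax : ℝ} (hR : ∀ a s s', |M.R a s s'| ≤ Rmax)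
    (hs : Summable fun t => M.aliveMean π s₀ H hH t fun _ => 1) :
    Integrable (M.ptReward π H hH) (M.ptLaw π s₀ H hH) :=
  (integrable_tsum_of_summable_integral_norm (M.integrable_alive_reward π s₀ hH)
    (M.summable_integral_norm_reward π s₀ hH hR hs)).congr
    (EventuallyEq.symm (M.ae_ptReward_eq_tsum π s₀ hH hs))

theorem hasSum_integral_ptReward {Rmax : ℝ} (hR : ∀ a s s', |M.R a s s'| ≤ Rmax)
    (hs : Summable fun t => M.aliveMean π s₀ H hH t fun _ => 1) :
    HasSum (fun t => M.aliveMean π s₀ H hH t (M.stepMean π fun s s' => M.R (π s) s s'))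
      (∫ ω, M.ptReward π H hH ω ∂(M.ptLaw π s₀ H hH)) := by
  rw [integral_congr_ae (M.ae_ptReward_eq_tsum π s₀ hH hs)]
  have h := hasSum_integral_of_summable_integral_norm (M.integrable_alive_reward π s₀ hH)
    (M.summable_integral_norm_reward π s₀ hH hR hs)
  exact h.congr_fun fun t => (M.integral_alive_step π s₀ hH t fun x y => M.R (π x) x y).symm

/-- The expected reward until termination is `H` times the ratio of the rates of reward and
difficulty, up to an error that does not depend on `H`. -/
theorem abs_integral_ptReward_sub_le {Rmax Dmax : ℝ} (hR : ∀ a s s', |M.R a s s'| ≤ Rmax)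
    (hD : ∀ a s s', M.D a s s' ≤ Dmax) {g h : S → ℝ} {b c Bg Bh : ℝ}
    (hg : ∀ s, M.Reach π s₀ s →
      M.stepMean π (fun s s' => M.R (π s) s s') s + M.nextMean π g s - g s = b)
    (hh : ∀ s, M.Reach π s₀ s →
      M.stepMean π (fun s s' => M.D (π s) s s') s + M.nextMean π h s - h s = c)
    (hc0 : 0 < c) (hBg : ∀ s, |g s| ≤ Bg) (hBh : ∀ s, |h s| ≤ Bh) :
    |∫ ω, M.ptReward π H hH ω ∂(M.ptLaw π s₀ H hH) - b / c * H| ≤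
      2 * Bg + |b / c| * (2 * Bh + (1 + Dmax)) := by
  have hs := M.summable_aliveMean_one π s₀ hH hD hh hc0
  have hDmax : 0 ≤ Dmax := (M.D_nonneg (π s₀) s₀ s₀).trans (hD _ _ _)
  -- Subtracting the vanishing `|b / c| * H * p`, with `p` the survival probability at `T`, leaves a
  -- bound at finite `T` that does not involve `H`.
  have hlim := (((M.hasSum_integral_ptReward π s₀ hH hR hs).tendsto_sum_nat.sub_const
    (b / c * H)).abs).sub (hs.tendsto_atTop_zero.const_mul (|b / c| * H))
  rw [mul_zero, sub_zero] at hlim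
  refine le_of_tendsto' hlim fun T => ?_
  have h1 := M.abs_sum_aliveMean_sub_le π s₀ hH hg hBg T
  have h2 := M.abs_sum_aliveMean_sub_le π s₀ hH hh hBh T
  have h3 := M.abs_sum_difficulty_sub_le π s₀ hH hD T
  have h4 := M.aliveMean_one_nonneg π s₀ hH T
  set x := ∑ t ∈ Finset.range T, M.aliveMean π s₀ H hH t (M.stepMean π fun s s' => M.R (π s) s s')
  set y := ∑ t ∈ Finset.range T, M.aliveMean π s₀ H hH t (M.stepMean π fun s s' => M.D (π s) s s')
  set N := ∑ t ∈ Finset.range T, M.aliveMean π s₀ H hH t fun _ => 1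
  set p := M.aliveMean π s₀ H hH T fun _ => 1
  have h5 : |y - H * (1 - p)| ≤ 1 + Dmax :=
    h3.trans (mul_le_of_le_one_right (by linarith) (by linarith))
  -- Compare `x` with `b * N`, then `c * N` with `y`, then `y` with `H * (1 - p)`.
  have hdecomp : x - b / c * H =
      (x - b * N) + (b / c) * (-(y - c * N) + (y - H * (1 - p)) - H * p) := by
    field_simp
    ring
  have h6 : |-(y - c * N) + (y - H * (1 - p)) - H * p| ≤ 2 * Bh + (1 + Dmax) + H * p := by
    have hHp : 0 ≤ H * p := mul_nonneg (by linarith) h4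
    rw [abs_le] at h2 h5 ⊢
    constructor <;> linarith [h2.1, h2.2, h5.1, h5.2]
  have h7 : |x - b / c * H| ≤ 2 * Bg + |b / c| * (2 * Bh + (1 + Dmax) + H * p) := by
    rw [hdecomp]
    refine (abs_add_le _ _).trans (add_le_add h1 ?_)
    rw [abs_mul]
    exact mul_le_mul_of_nonneg_left h6 (abs_nonneg _)
  linarith

end Term

end MDP

/-! ### Comparison of the two revenues. -/

theorem theorem1 {S A : Type*} [Fintype S] [Finite A]
    [MeasurableSpace S] [DiscreteMeasurableSpace S]
    (M : MDP S A) (sInit : S) (Rmax Dmax ε : ℝ)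
    (hR : ∀ a s s', |M.R a s s'| ≤ Rmax)
    (hD : ∀ a s s', M.D a s s' ≤ Dmax)
    (hε : 0 < ε)
    (havg : ∀ π : S → A, ε < M.avgDifficulty π sInit)
    (hrec : ∀ π : S → A, M.IsPositiveRecurrent π sInit)
    (π : S → A) :
    ((∀ᵐ ω ∂(M.law π sInit), ∃ l : ℝ,
        Tendsto (fun T : ℕ => M.cumReward π T ω / M.cumDifficulty π T ω) atTop (𝓝 l)) ∧
      Integrable (M.limitRatio π) (M.law π sInit)) ∧
    (∀ (H : ℝ) (hH : 1 < H),
      (∀ᵐ ω ∂(M.ptLaw π sInit H hH), ∃ t : ℕ, 1 ≤ t ∧ (ω t).2 = false) ∧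
      Integrable (M.ptReward π H hH) (M.ptLaw π sInit H hH)) ∧
    ∃ C : ℝ, ∀ (H : ℝ) (hH : 1 < H),
      |M.revARR π sInit - M.revPT π sInit H hH| ≤ C / H := by
  have hback : ∀ s, M.Reach π sInit s → M.Reach π s sInit := fun s hs =>
    M.reach_of_ae_return π (hrec π).1 hs
  obtain ⟨b, g, hg⟩ := M.exists_poisson π hback (M.stepMean π fun s s' => M.R (π s) s s')
  obtain ⟨c, h, hh⟩ := M.exists_poisson π hback (M.stepMean π fun s s' => M.D (π s) s s')
  have hlimR := M.ae_tendsto_average π sInit hg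
  have hlimD := M.ae_tendsto_average π sInit hh
  -- By the ergodic theorem `c` is the average difficulty, which exceeds `ε`.
  have hc0 : 0 < c := by
    have hae : ∀ᵐ ω ∂(M.law π sInit),
        limUnder atTop (fun T : ℕ => (1 / (T : ℝ)) * M.cumDifficulty π T ω) = c := by
      filter_upwards [hlimD] with ω hω
      refine (hω.congr fun T => ?_).limUnder_eq
      rw [MDP.cumDifficulty]
      ring
    have havg' := havg π
    rw [MDP.avgDifficulty, integral_congr_ae hae] at havg'
    simp only [integral_const, probReal_univ, smul_eq_mul, one_mul] at havg'
    linarith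
  have hratio : ∀ᵐ ω ∂(M.law π sInit), Tendsto
      (fun T : ℕ => M.cumReward π T ω / M.cumDifficulty π T ω) atTop (𝓝 (b / c)) := by
    filter_upwards [hlimR, hlimD] with ω h1 h2
    refine (h1.div h2 hc0.ne').congr' ?_
    filter_upwards [eventually_ge_atTop 1] with T hT
    have hT' : (T : ℝ) ≠ 0 := by positivity
    exact div_div_div_cancel_right₀ hT' _ _
  have hlimRatio : ∀ᵐ ω ∂(M.law π sInit), M.limitRatio π ω = b / c := by
    filter_upwards [hratio] with ω hω
    exact hω.limUnder_eq
  have hARR : M.revARR π sInit = b / c := by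
    rw [MDP.revARR, integral_congr_ae hlimRatio]
    simp
  refine ⟨⟨hratio.mono fun ω hω => ⟨_, hω⟩,
    (integrable_const (b / c)).congr (EventuallyEq.symm hlimRatio)⟩, fun H hH => ?_, ?_⟩
  · have hs := M.summable_aliveMean_one π sInit hH hD hh hc0
    exact ⟨M.ae_ptLaw_exists_term π sInit hH hs, M.integrable_ptReward π sInit hH hR hs⟩
  · obtain ⟨Bg, hBg⟩ := Finite.exists_le fun s => |g s|
    obtain ⟨Bh, hBh⟩ := Finite.exists_le fun s => |h s|
    -- Every ingredient comes from the original chain, so the constant does not depend on `H`.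
    refine ⟨2 * Bg + |b / c| * (2 * Bh + (1 + Dmax)), fun H hH => ?_⟩
    have hH0 : 0 < H := by linarith
    have hbound := M.abs_integral_ptReward_sub_le π sInit hH hR hD hg hh hc0 hBg hBh
    rw [hARR, MDP.revPT, integral_const_mul, le_div_iff₀ hH0]
    refine le_trans (le_of_eq ?_) hbound
    have habs : ∀ x : ℝ, |b / c - 1 / H * x| * H = |x - b / c * H| := fun x => by
      rw [abs_sub_comm, ← abs_of_pos hH0, ← abs_mul, abs_of_pos hH0]
      congr 1
      field_simp
    exact habs _
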